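/- Let $n\ge 1$ and let $S_n\subseteq S_{n+1}$ be the natural embedding (permutations fixing the last point), with group algebras $R=\mathbb{C}S_n\subseteq H=\mathbb{C}S_{n+1}$. Conventions. For modules $M,N$ over a ring write $M\,\|\,N$ if $M\oplus P\cong N$ for some module $P$, and write $M\sim N$ ($M$ and $N$ are similar) if $M\,\|\,qN$ and $N\,\|\,rM$ for some $q,r\in\mathbb{N}$, where $qN=N\oplus\cdots\oplus N$ ($q$ summands). A subalgebra $B\subseteq A$ has h-depth $2m-1$ ($m\ge 1$) if $A^{\otimes_B(m+1)}\sim A^{\otimes_B m}$ as $A$-$A$-bimodules; $d_h(B,A)$ is the minimum h-depth. For a group $G$ let $\mathcal{M}_G$ be the category of finite-dimensional right $\mathbb{C}G$-modules, with tensor product over $\mathbb{C}$ and diagonal action. For $W\in\mathcal{M}_G$ put $T_0(W)=\mathbb{C}$ (the trivial module) and $T_m(W)=W\oplus W^{\otimes 2}\oplus\cdots\oplus W^{\otimes m}$ for $m\ge 1$; the module $W$ has depth $m\ge 0$ if $T_{m+1}(W)\,\|\,q\,T_m(W)$ for some $q\in\mathbb{N}$, and $d(W,\mathcal{M}_G)$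 is the minimum depth. Let $V=H/R^+H$, where $R^+$ is the kernel of the counit (augmentation) of $R$; this is the permutation module $\mathbb{C}[S_n\backslash S_{n+1}]$ on right cosets, a right $S_{n+1}$-module and by restriction a right $S_n$-module. Then $$d_h(\mathbb{C}S_n,\mathbb{C}S_{n+1})=2n+1,\qquad d(V,\mathcal{M}_{S_n})=n-1,\qquad d(V,\mathcal{M}_{S_{n+1}})=n.$$ -/

import Mathlib

open scoped TensorProduct

noncomputable section

universe v

namespace SubalgebraDepth

/-! ### Divisibility and similarity of modules -/

/-- `M ∣ N`: there is a module `P` with `M ⊕ P ≅ N`. -/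
def Divides (R : Type*) [Ring R] (M : Type*) [AddCommGroup M] [Module R M]
    (N : Type v) [AddCommGroup N] [Module R N] : Prop :=
  ∃ (P : Type v) (_ : AddCommGroup P) (_ : Module R P), Nonempty ((M × P) ≃ₗ[R] N)

/-- `M` divides a multiple `q N = N ⊕ ⋯ ⊕ N` of `N`. -/
def DividesMultiple (R : Type*) [Ring R] (M : Type*) [AddCommGroup M] [Module R M]
    (N : Type*) [AddCommGroup N] [Module R N] : Prop :=
  ∃ q : ℕ, Divides R M (Fin q → N)

/-- Similarity `M ∼ N`: each of the two modules divides a multiple of the other. -/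
def Similar (R : Type*) [Ring R] (M : Type*) [AddCommGroup M] [Module R M]
    (N : Type*) [AddCommGroup N] [Module R N] : Prop :=
  DividesMultiple R M N ∧ DividesMultiple R N M

/-! ### The `A`-`A`-bimodules `A ⊗_B ⋯ ⊗_B A` and the h-depth of a subalgebra -/

section HDepth

variable {k A : Type*} [Field k] [Ring A] [Algebra k A]

/-- The relations
`a₀ ⊗ ⋯ ⊗ aᵢ b ⊗ aᵢ₊₁ ⊗ ⋯ ⊗ aⱼ = a₀ ⊗ ⋯ ⊗ aᵢ ⊗ b aᵢ₊₁ ⊗ ⋯ ⊗ aⱼ` (`b ∈ B`)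
in the `(j+1)`-fold tensor power of `A` over the ground field. -/
def balancedRel (B : Subalgebra k A) (j : ℕ) : Submodule k (⨂[k]^(j + 1) A) :=
  Submodule.span k {t | ∃ (x : Fin (j + 1) → A) (i : Fin j) (b : A), b ∈ B ∧
    t = PiTensorProduct.tprod k (Function.update x i.castSucc (x i.castSucc * b)) -
        PiTensorProduct.tprod k (Function.update x i.succ (b * x i.succ))}

/-- `BalancedPower B j` is `A ⊗_B ⋯ ⊗_B A` with `j + 1` factors `A` (so with `j` signs `⊗_B`). -/
def BalancedPower (B : Subalgebra k A) (j : ℕ) : Type _ :=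
  (⨂[k]^(j + 1) A) ⧸ balancedRel B j

instance (B : Subalgebra k A) (j : ℕ) : AddCommGroup (BalancedPower B j) :=
  inferInstanceAs (AddCommGroup ((⨂[k]^(j + 1) A) ⧸ balancedRel B j))

instance (B : Subalgebra k A) (j : ℕ) : Module k (BalancedPower B j) :=
  inferInstanceAs (Module k ((⨂[k]^(j + 1) A) ⧸ balancedRel B j))

/-- A `k`-linear map acting on the tensor factor number `i` only. -/
def actAt (j : ℕ) (i : Fin (j + 1)) (f : A →ₗ[k] A) :
    (⨂[k]^(j + 1) A) →ₗ[k] (⨂[k]^(j + 1) A) :=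
  PiTensorProduct.map (Function.update (fun _ => LinearMap.id) i f)

theorem actAt_tprod (j : ℕ) (i : Fin (j + 1)) (f : A →ₗ[k] A) (x : Fin (j + 1) → A) :
    actAt j i f (PiTensorProduct.tprod k x) =
      PiTensorProduct.tprod k (Function.update x i (f (x i))) := by
  refine (PiTensorProduct.map_tprod _ _).trans (congrArg _ ?_)
  funext l
  by_cases h : l = i
  · subst h; simp
  · simp [h]

theorem left_balancedRel (B : Subalgebra k A) (j : ℕ) (a : A) :
    balancedRel B j ≤ (balancedRel B j).comap (actAt j 0 (LinearMap.mulLeft k a)) := by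
  refine Submodule.span_le.2 ?_
  rintro _ ⟨x, i, b, hb, rfl⟩
  refine Submodule.subset_span ⟨Function.update x 0 (a * x 0), i, b, hb, ?_⟩
  rw [map_sub, actAt_tprod, actAt_tprod]
  congr 2
  · funext l
    by_cases h0 : l = 0 <;> by_cases hi : i.castSucc = 0 <;> by_cases hl : l = i.castSucc <;>
      simp_all [Function.update_apply, mul_assoc]
  · funext l
    by_cases h0 : l = 0 <;> by_cases hl : l = i.succ <;>
      simp_all [Function.update_apply, (Fin.succ_ne_zero i).symm, Fin.succ_ne_zero i]

theorem right_balancedRel (B : Subalgebra k A) (j : ℕ) (a : A) :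
    balancedRel B j ≤
      (balancedRel B j).comap (actAt j (Fin.last j) (LinearMap.mulRight k a)) := by
  refine Submodule.span_le.2 ?_
  rintro _ ⟨x, i, b, hb, rfl⟩
  refine Submodule.subset_span
    ⟨Function.update x (Fin.last j) (x (Fin.last j) * a), i, b, hb, ?_⟩
  rw [map_sub, actAt_tprod, actAt_tprod]
  congr 2
  · funext l
    by_cases h0 : l = Fin.last j <;> by_cases hl : l = i.castSucc <;>
      simp_all [Function.update_apply, (Fin.castSucc_ne_last i).symm,
        Fin.castSucc_ne_last i]
  · funext l
    by_cases h0 : l = Fin.last j <;> by_cases hi : i.succ = Fin.last j <;>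
      by_cases hl : l = i.succ <;> simp_all [Function.update_apply, mul_assoc]

/-- The element `x₀ ⊗_B ⋯ ⊗_B xⱼ` of `A ⊗_B ⋯ ⊗_B A`. -/
def BalancedPower.mk (B : Subalgebra k A) (j : ℕ) (x : Fin (j + 1) → A) : BalancedPower B j :=
  (balancedRel B j).mkQ (PiTensorProduct.tprod k x)

theorem BalancedPower.mk_update_add (B : Subalgebra k A) (j : ℕ) (x : Fin (j + 1) → A)
    (i : Fin (j + 1)) (a b : A) : mk B j (Function.update x i (a + b)) =
      mk B j (Function.update x i a) + mk B j (Function.update x i b) := by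
  refine (congrArg (balancedRel B j).mkQ (MultilinearMap.map_update_add _ x i a b)).trans ?_
  exact map_add (balancedRel B j).mkQ _ _

theorem BalancedPower.mk_update_smul (B : Subalgebra k A) (j : ℕ) (x : Fin (j + 1) → A)
    (i : Fin (j + 1)) (c : k) (a : A) : mk B j (Function.update x i (c • a)) =
      c • mk B j (Function.update x i a) := by
  refine (congrArg (balancedRel B j).mkQ (MultilinearMap.map_update_smul _ x i c a)).trans ?_
  exact map_smul (balancedRel B j).mkQ _ _

theorem BalancedPower.end_ext {B : Subalgebra k A} {j : ℕ}
    {f g : Module.End k (BalancedPower B j)}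
    (h : ∀ x : Fin (j + 1) → A, f (mk B j x) = g (mk B j x)) : f = g :=
  Submodule.linearMap_qext _ (PiTensorProduct.ext (MultilinearMap.ext h))

/-- Left multiplication by `a` on the first factor. -/
def leftMul (B : Subalgebra k A) (j : ℕ) (a : A) : Module.End k (BalancedPower B j) :=
  (balancedRel B j).mapQ _ (actAt j 0 (LinearMap.mulLeft k a)) (left_balancedRel B j a)

/-- Right multiplication by `a` on the last factor. -/
def rightMul (B : Subalgebra k A) (j : ℕ) (a : A) : Module.End k (BalancedPower B j) :=
  (balancedRel B j).mapQ _ (actAt j (Fin.last j) (LinearMap.mulRight k a))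
    (right_balancedRel B j a)

theorem leftMul_mk (B : Subalgebra k A) (j : ℕ) (a : A) (x : Fin (j + 1) → A) :
    leftMul B j a (BalancedPower.mk B j x) =
      BalancedPower.mk B j (Function.update x 0 (a * x 0)) :=
  congrArg (balancedRel B j).mkQ (actAt_tprod j 0 (LinearMap.mulLeft k a) x)

theorem rightMul_mk (B : Subalgebra k A) (j : ℕ) (a : A) (x : Fin (j + 1) → A) :
    rightMul B j a (BalancedPower.mk B j x) =
      BalancedPower.mk B j (Function.update x (Fin.last j) (x (Fin.last j) * a)) :=
  congrArg (balancedRel B j).mkQ (actAt_tprod j (Fin.last j) (LinearMap.mulRight k a) x)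

/-- The left `A`-action on `A ⊗_B ⋯ ⊗_B A`. -/
def leftAct (B : Subalgebra k A) (j : ℕ) : A →ₐ[k] Module.End k (BalancedPower B j) :=
  AlgHom.ofLinearMap
    { toFun := leftMul B j
      map_add' := fun a b => BalancedPower.end_ext fun x => by
        simp only [LinearMap.add_apply, leftMul_mk, add_mul, BalancedPower.mk_update_add]
      map_smul' := fun c a => BalancedPower.end_ext fun x => by
        simp only [LinearMap.smul_apply, leftMul_mk, smul_mul_assoc,
          BalancedPower.mk_update_smul, RingHom.id_apply] }
    (BalancedPower.end_ext fun x => by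
      change leftMul B j 1 _ = _
      simp [leftMul_mk])
    (fun a b => BalancedPower.end_ext fun x => by
      rw [Module.End.mul_apply]
      change leftMul B j (a * b) _ = leftMul B j a (leftMul B j b _)
      simp [leftMul_mk, mul_assoc])

/-- The right `A`-action on `A ⊗_B ⋯ ⊗_B A`. -/
def rightAct (B : Subalgebra k A) (j : ℕ) : Aᵐᵒᵖ →ₐ[k] Module.End k (BalancedPower B j) :=
  AlgHom.ofLinearMap
    { toFun := fun a => rightMul B j a.unop
      map_add' := fun a b => BalancedPower.end_ext fun x => by
        simp only [LinearMap.add_apply, rightMul_mk, MulOpposite.unop_add, mul_add,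
          BalancedPower.mk_update_add]
      map_smul' := fun c a => BalancedPower.end_ext fun x => by
        simp only [LinearMap.smul_apply, rightMul_mk, MulOpposite.unop_smul, mul_smul_comm,
          BalancedPower.mk_update_smul, RingHom.id_apply] }
    (BalancedPower.end_ext fun x => by
      change rightMul B j 1 _ = _
      simp [rightMul_mk])
    (fun a b => BalancedPower.end_ext fun x => by
      rw [Module.End.mul_apply]
      change rightMul B j (b.unop * a.unop) _ = rightMul B j a.unop (rightMul B j b.unop _)
      simp [rightMul_mk, mul_assoc])

theorem leftAct_commute_rightAct (B : Subalgebra k A) (j : ℕ) (a : A) (b : Aᵐᵒᵖ) :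
    Commute (leftAct B j a) (rightAct B j b) :=
  BalancedPower.end_ext fun x => by
    rw [Module.End.mul_apply, Module.End.mul_apply]
    change leftMul B j a (rightMul B j b.unop _) = rightMul B j b.unop (leftMul B j a _)
    rw [rightMul_mk, leftMul_mk, leftMul_mk, rightMul_mk]
    congr 1
    funext l
    by_cases h : (0 : Fin (j + 1)) = Fin.last j
    · simp [← h, mul_assoc]
    · by_cases h0 : l = 0 <;> by_cases hl : l = Fin.last j <;>
        simp_all [Ne.symm h]

/-- `A ⊗_B ⋯ ⊗_B A` as an `A`-`A`-bimodule, that is as a module over the enveloping algebra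
`A ⊗ Aᵒᵖ`, where `a ⊗ c` acts by `t ↦ a t c`. -/
instance (B : Subalgebra k A) (j : ℕ) : Module (A ⊗[k] Aᵐᵒᵖ) (BalancedPower B j) :=
  Module.compHom (BalancedPower B j)
    (Algebra.TensorProduct.lift (leftAct B j) (rightAct B j)
      (leftAct_commute_rightAct B j)).toRingHom

/-- `B ⊆ A` has h-depth `2m - 1` (`m ≥ 1`) if the `A`-`A`-bimodules `A ⊗_B ⋯ ⊗_B A` with `m + 1`
and with `m` factors are similar. Here `m = j + 1`, so that `2m - 1 = 2j + 1`. -/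
def HasHDepth (B : Subalgebra k A) (d : ℕ) : Prop :=
  ∃ j : ℕ, d = 2 * j + 1 ∧
    Similar (A ⊗[k] Aᵐᵒᵖ) (BalancedPower B (j + 1)) (BalancedPower B j)

/-- `d` is the minimum h-depth `d_h(B, A)` of the subalgebra `B` of `A`. -/
def IsMinHDepth (B : Subalgebra k A) (d : ℕ) : Prop :=
  IsLeast {e : ℕ | HasHDepth B e} d

end HDepth

/-! ### Depth of a module over a group algebra

A right `k[G]`-module is a representation of the opposite group `Gᵐᵒᵖ`, and the tensor product
in the category of right `k[G]`-modules carries the diagonal action of `G`. The definitions below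
are for representations of an arbitrary group and are applied to opposite groups. -/

section ModuleDepth

variable {k G W : Type*} [Field k] [Group G] [AddCommGroup W] [Module k W]

/-- The tensor power `W ⊗ ⋯ ⊗ W` (`m` factors, the trivial module `k` for `m = 0`) with the
diagonal action of `G`. -/
def tensorPowerRep (ρ : Representation k G W) (m : ℕ) : Representation k G (⨂[k]^m W) where
  toFun g := PiTensorProduct.map fun _ => ρ g
  map_one' := by
    rw [map_one]
    exact PiTensorProduct.map_one
  map_mul' g h := by
    rw [map_mul]
    exact PiTensorProduct.map_mul (fun _ => ρ g) (fun _ => ρ h)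

/-- The exponents that occur in the truncated tensor algebra: `1, …, n` for `n ≥ 1`, and only
`0` for `n = 0`. -/
def truncExponents (n : ℕ) : Finset ℕ :=
  if n = 0 then {0} else Finset.Icc 1 n

/-- The truncated tensor algebra `T_n(W) = W ⊕ (W ⊗ W) ⊕ ⋯ ⊕ W^{⊗ n}` for `n ≥ 1`, and
`T_0(W) = k`, as a module over the group algebra of `G`. -/
abbrev TruncatedTensor (ρ : Representation k G W) (n : ℕ) : Type _ :=
  ∀ i : truncExponents n, (tensorPowerRep ρ i).asModule

/-- `W` has depth `n` if `T_{n+1}(W)` divides a multiple of `T_n(W)`. -/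
def HasModuleDepth (ρ : Representation k G W) (n : ℕ) : Prop :=
  DividesMultiple (MonoidAlgebra k G) (TruncatedTensor ρ (n + 1)) (TruncatedTensor ρ n)

/-- `n` is the minimum depth of `W`. -/
def IsMinModuleDepth (ρ : Representation k G W) (n : ℕ) : Prop :=
  IsLeast {m : ℕ | HasModuleDepth ρ m} n

end ModuleDepth

/-! ### The permutation module `V = H / R⁺H` for `H = k[G]` -/

section PermutationModule

variable {k G : Type*} [Field k] [Group G]

/-- `R⁺H`, where `R⁺` is the kernel of the counit of `H = k[G]` restricted to `R`. -/
def augmentationMul (R : Subalgebra k (MonoidAlgebra k G)) :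
    Submodule k (MonoidAlgebra k G) :=
  (Subalgebra.toSubmodule R ⊓
    LinearMap.ker (Coalgebra.counit : MonoidAlgebra k G →ₗ[k] k)) * ⊤

theorem augmentationMul_le_comap (R : Subalgebra k (MonoidAlgebra k G)) (h : MonoidAlgebra k G) :
    augmentationMul R ≤ (augmentationMul R).comap (LinearMap.mulRight k h) := by
  refine Submodule.mul_le.2 fun r hr x _ => ?_
  rw [Submodule.mem_comap, LinearMap.mulRight_apply, mul_assoc]
  exact Submodule.mul_mem_mul hr Submodule.mem_top

/-- The right `H`-module `V = H / R⁺H` for `H = k[G]`, given by the right action of `G`, that is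
by a representation of the opposite group: `g` sends the class of `h` to the class of `h g`. -/
def permutationModule (R : Subalgebra k (MonoidAlgebra k G)) :
    Representation k Gᵐᵒᵖ (MonoidAlgebra k G ⧸ augmentationMul R) where
  toFun g := (augmentationMul R).mapQ _
    (LinearMap.mulRight k (MonoidAlgebra.of k G g.unop)) (augmentationMul_le_comap R _)
  map_one' := by
    refine Submodule.linearMap_qext _ (LinearMap.ext fun x => ?_)
    simp [← MonoidAlgebra.one_def]
  map_mul' g h := by
    refine Submodule.linearMap_qext _ (LinearMap.ext fun x => ?_)
    simp [mul_assoc]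

end PermutationModule

/-! ### The symmetric group algebras `ℂ S_n ⊆ ℂ S_{n+1}` -/

/-- The natural embedding `S_n → S_{n+1}`: permutations are extended by fixing the last point. -/
def symEmb (n : ℕ) : Equiv.Perm (Fin n) →* Equiv.Perm (Fin (n + 1)) :=
  Equiv.Perm.viaEmbeddingHom Fin.castSuccEmb

/-- `ℂ S_n` as a subalgebra of `ℂ S_{n+1}`. -/
def symSubalgebra (n : ℕ) : Subalgebra ℂ (MonoidAlgebra ℂ (Equiv.Perm (Fin (n + 1)))) :=
  (MonoidAlgebra.mapDomainAlgHom ℂ ℂ (symEmb n)).range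

/-- The permutation module `V` of `ℂ S_n ⊆ ℂ S_{n+1}`, as a right `S_{n+1}`-module. -/
def symPerm (n : ℕ) : Representation ℂ (Equiv.Perm (Fin (n + 1)))ᵐᵒᵖ
    (MonoidAlgebra ℂ (Equiv.Perm (Fin (n + 1))) ⧸ augmentationMul (symSubalgebra n)) :=
  permutationModule (symSubalgebra n)

/-- The permutation module `V` of `ℂ S_n ⊆ ℂ S_{n+1}`, restricted to a right `S_n`-module. -/
def symPermRes (n : ℕ) : Representation ℂ (Equiv.Perm (Fin n))ᵐᵒᵖ
    (MonoidAlgebra ℂ (Equiv.Perm (Fin (n + 1))) ⧸ augmentationMul (symSubalgebra n)) :=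
  (symPerm n).comp (MonoidHom.op (symEmb n))

end SubalgebraDepth

end

/-!
All modules involved are permutation modules. The tensor power `V^{⊗ r}` has a basis permuted like
the `r`-tuples of points of `X = G / H`, and `A ⊗_B ⋯ ⊗_B A` with `j` signs `⊗_B`, for group
algebras `B = k[H] ⊆ A = k[G]`, has a basis permuted by `G × G` like `X ^ j × G`. Over any field,
such a module divides a multiple of another one as soon as every stabilizer of a basis element of
the first occurs in the second. A permutation of `n + 1` points fixing `n` of them is the identity,
so one entry of an `(n + 1)`-tuple can be dropped without changing the stabilizer: this gives the
upper bounds. For the lower bounds, the antisymmetrizer `∑ sign(σ) σ` over the permutations of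
`m + 2` points kills every tuple of at most `m` points, since such a tuple is fixed by a
transposition, but it does not kill a tuple of `m + 1` of these points, which is fixed by no
nontrivial permutation.
-/

namespace SubalgebraDepth

/-! ### Permutation bases -/

section Divisibility

variable {R M N : Type*} [Ring R] [AddCommGroup M] [Module R M] [AddCommGroup N] [Module R N]

theorem Divides.of_leftInverse (i : M →ₗ[R] N) (r : N →ₗ[R] M) (h : r ∘ₗ i = .id) :
    Divides R M N := by
  have hri : Function.LeftInverse r i := LinearMap.congr_fun h
  refine ⟨LinearMap.ker r, inferInstance, inferInstance, ⟨LinearEquiv.ofBijective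
    (i.coprod (LinearMap.ker r).subtype) ⟨?_, fun y => ?_⟩⟩⟩
  · refine (injective_iff_map_eq_zero _).2 fun ⟨m, p⟩ hmp => ?_
    have hm : m = 0 := by simpa [hri m] using congrArg r hmp
    subst hm
    simpa using hmp
  · exact ⟨(r y, ⟨y - i (r y), by simp [hri (r y)]⟩), by simp⟩

theorem DividesMultiple.smul_eq_zero (h : DividesMultiple R M N) {a : R}
    (ha : ∀ y : N, a • y = 0) (x : M) : a • x = 0 := by
  obtain ⟨q, P, _, _, ⟨e⟩⟩ := h
  have he : e (a • (x, 0)) = 0 := by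
    rw [map_smul]
    exact funext fun i => ha _
  exact congrArg Prod.fst (e.map_eq_zero_iff.1 he)

end Divisibility

/-- Modules over a `k`-algebra `R` are described through a group `Γ` by means of a monoid
homomorphism `u : Γ →* R`, whose image will span `R`. The `k`-basis `b` of the `R`-module `M`,
indexed by a `Γ`-set, is a permutation basis if `Γ` permutes it in the same way as its indices. -/
def IsPermutationBasis {k R M Γ X : Type*} [CommRing k] [Ring R] [AddCommGroup M] [Module k M]
    [Module R M] [Group Γ] [MulAction Γ X] (u : Γ →* R) (b : Module.Basis X k M) : Prop :=
  ∀ g x, u g • b x = b (g • x)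

theorem IsPermutationBasis.pi {ι k R Γ : Type*} [Fintype ι] [CommRing k] [Ring R] [Group Γ]
    {N Y : ι → Type*} [∀ i, AddCommGroup (N i)] [∀ i, Module k (N i)] [∀ i, Module R (N i)]
    [∀ i, MulAction Γ (Y i)] {u : Γ →* R} {c : ∀ i, Module.Basis (Y i) k (N i)}
    (hc : ∀ i, IsPermutationBasis u (c i)) : IsPermutationBasis u (Pi.basis c) := by
  classical
  rintro g ⟨i, y⟩
  rw [Sigma.smul_mk, Pi.basis_apply, Pi.basis_apply, ← hc i g y, Pi.single_smul]

theorem IsPermutationBasis.restrict {k R M Γ X : Type*} [CommRing k] [Ring R] [AddCommGroup M]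
    [Module k M] [Module R M] [Group Γ] [MulAction Γ X] {u : Γ →* R} {b : Module.Basis X k M}
    (hb : IsPermutationBasis u b) (K : Subgroup Γ) : IsPermutationBasis (u.comp K.subtype) b :=
  fun g x => hb g x

section PermutationBasis

variable {k R M N Γ X Y : Type*} [CommRing k] [Ring R] [Algebra k R]
  [AddCommGroup M] [Module k M] [Module R M] [IsScalarTower k R M]
  [AddCommGroup N] [Module k N] [Module R N] [IsScalarTower k R N]
  [Group Γ] {u : Γ →* R}

theorem exists_linearMap_of_span_eq_top (hu : Submodule.span k (Set.range u) = ⊤)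
    (b : Module.Basis X k M) (f : M →ₗ[k] N) (hf : ∀ g x, f (u g • b x) = u g • f (b x)) :
    ∃ F : M →ₗ[R] N, ∀ m, F m = f m := by
  refine ⟨{ f with map_smul' := fun a m => ?_ }, fun _ => rfl⟩
  have ha : a ∈ Submodule.span k (Set.range u) := hu ▸ Submodule.mem_top
  change f (a • m) = a • f m
  induction ha using Submodule.span_induction with
  | mem a ha =>
    obtain ⟨g, rfl⟩ := ha
    have hfg : f ∘ₗ Algebra.lsmul k k M (u g) = Algebra.lsmul k k N (u g) ∘ₗ f :=
      b.ext (hf g)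
    exact LinearMap.congr_fun hfg m
  | zero => simp only [zero_smul, map_zero]
  | add a a' _ _ ha ha' => simp only [add_smul, map_add, ha, ha']
  | smul s a _ ha => simp only [smul_assoc, map_smul, ha]

variable [MulAction Γ X] [MulAction Γ Y] {b : Module.Basis X k M} {c : Module.Basis Y k N}

/- The inclusion maps basis elements along `f`; the retraction is its transpose, which kills the
basis elements outside the range of `f`. -/
theorem IsPermutationBasis.divides (hu : Submodule.span k (Set.range u) = ⊤)
    (hb : IsPermutationBasis u b) (hc : IsPermutationBasis u c) (f : X →[Γ] Y)
    (hf : Function.Injective f) : Divides R M N := by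
  obtain ⟨i, hi⟩ := exists_linearMap_of_span_eq_top hu b (b.constr k (c ∘ f)) fun g x => by
    simp [hb g x, hc g (f x)]
  obtain ⟨r, hr⟩ := exists_linearMap_of_span_eq_top hu c
      (c.constr k (Function.extend f b 0)) fun g y => by
    rw [hc g y, c.constr_basis, c.constr_basis]
    by_cases hy : ∃ x, f x = y
    · obtain ⟨x, rfl⟩ := hy
      rw [← map_smul, hf.extend_apply, hf.extend_apply, hb]
    · have hgy : ¬ ∃ x, f x = g • y := fun ⟨x, hx⟩ =>
        hy ⟨g⁻¹ • x, by rw [map_smul, hx, inv_smul_smul]⟩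
      simp [Function.extend_apply' _ _ _ hy, Function.extend_apply' _ _ _ hgy]
  have hri : (r ∘ₗ i).restrictScalars k = .id := b.ext fun x => by
    simp [hi, hr, hf.extend_apply]
  exact .of_leftInverse i r (LinearMap.ext fun m => LinearMap.congr_fun hri m)

end PermutationBasis

section Orbits

variable {Γ X Y : Type*} [Group Γ] [MulAction Γ X] [MulAction Γ Y]

theorem exists_mulActionHom_stabilizer_eq
    (h : ∀ x : X, ∃ y : Y, MulAction.stabilizer Γ x = MulAction.stabilizer Γ y) :
    ∃ f : X →[Γ] Y, ∀ x, MulAction.stabilizer Γ x = MulAction.stabilizer Γ (f x) := by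
  let rep (x : X) : X := Quotient.out (Quotient.mk (MulAction.orbitRel Γ X) x)
  have hrep_smul (g : Γ) (x : X) : rep (g • x) = rep x :=
    congrArg Quotient.out (Quotient.sound ⟨g, rfl⟩)
  have hrep (x : X) : ∃ a : Γ, a • rep x = x :=
    MulAction.orbitRel_apply.1 ((MulAction.orbitRel Γ X).symm (Quotient.mk_out x))
  choose a ha using hrep
  choose y hy using h
  have hmove (g : Γ) (x : X) :
      g • a x • y (rep x) = a (g • x) • y (rep x) ↔ g • a x • rep x = a (g • x) • rep x := by
    have := SetLike.ext_iff.1 (hy (rep x)) ((a (g • x))⁻¹ * (g * a x))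
    simpa only [MulAction.mem_stabilizer_iff, mul_smul, inv_smul_eq_iff] using this.symm
  refine ⟨⟨fun x => a x • y (rep x), fun g x => ?_⟩, fun x => ?_⟩
  · dsimp only [id]
    rw [hrep_smul, eq_comm, hmove, ha, ← hrep_smul g x, ha]
  · ext g
    have := SetLike.ext_iff.1 (hy (rep x)) ((a x)⁻¹ * (g * a x))
    simp only [MulAction.mem_stabilizer_iff, mul_smul, inv_smul_eq_iff, ha] at this
    exact this

theorem exists_injective_mulActionHom_sigma [Finite (MulAction.orbitRel.Quotient Γ X)]
    (h : ∀ x : X, ∃ y : Y, MulAction.stabilizer Γ x = MulAction.stabilizer Γ y) :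
    ∃ (q : ℕ) (f : X →[Γ] Σ _ : Fin q, Y), Function.Injective f := by
  obtain ⟨f, hf⟩ := exists_mulActionHom_stabilizer_eq h
  obtain ⟨q, ⟨e⟩⟩ := Finite.exists_equiv_fin (MulAction.orbitRel.Quotient Γ X)
  refine ⟨q, ⟨fun x => ⟨e (Quotient.mk _ x), f x⟩, fun g x => ?_⟩, fun x x' hxx' => ?_⟩
  · rw [map_smul, id, Sigma.smul_mk]
    exact congrArg (Sigma.mk · _) (congrArg e (Quotient.sound ⟨g, rfl⟩))
  · obtain ⟨horbit, hfx⟩ := Sigma.mk.inj hxx'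
    obtain ⟨g, rfl⟩ := MulAction.orbitRel_apply.1 (Quotient.exact (e.injective horbit))
    have hg : g ∈ MulAction.stabilizer Γ (f x') := by
      rw [MulAction.mem_stabilizer_iff, ← map_smul]
      exact eq_of_heq hfx
    exact MulAction.mem_stabilizer_iff.1 (hf x' ▸ hg)

end Orbits

theorem IsPermutationBasis.dividesMultiple {k R M N Γ X Y : Type*} [CommRing k] [Ring R]
    [Algebra k R] [AddCommGroup M] [Module k M] [Module R M] [IsScalarTower k R M]
    [AddCommGroup N] [Module k N] [Module R N] [IsScalarTower k R N] [Group Γ] [MulAction Γ X]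
    [MulAction Γ Y] [Finite (MulAction.orbitRel.Quotient Γ X)] {u : Γ →* R}
    {b : Module.Basis X k M} {c : Module.Basis Y k N}
    (hu : Submodule.span k (Set.range u) = ⊤)
    (hb : IsPermutationBasis u b) (hc : IsPermutationBasis u c)
    (h : ∀ x : X, ∃ y : Y, MulAction.stabilizer Γ x = MulAction.stabilizer Γ y) :
    DividesMultiple R M N := by
  obtain ⟨q, f, hf⟩ := exists_injective_mulActionHom_sigma h
  exact ⟨q, hb.divides hu (.pi fun _ => hc) f hf⟩

theorem sum_intUnits_smul_eq_zero {Γ A : Type*} [Group Γ] [Fintype Γ] [AddCommGroup A]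
    (χ : Γ →* ℤˣ) (f : Γ → A) {g₀ : Γ} (hχ : χ g₀ = -1) (hf : ∀ g, f (g * g₀) = f g) :
    ∑ g, χ g • f g = 0 := by
  have hf' (g : Γ) : f (g * g₀⁻¹) = f g := by simpa using (hf (g * g₀⁻¹)).symm
  have hne : g₀ ≠ 1 := by rintro rfl; exact absurd hχ (by simp)
  refine Finset.sum_involution
    (fun g _ => if χ g = 1 then g * g₀ else g * g₀⁻¹) (fun g _ => ?_) (fun g _ _ => ?_)
    (fun _ _ => Finset.mem_univ _) fun g _ => ?_ <;>
  rcases Int.units_eq_one_or (χ g) with hg | hg <;> simp [hg, hχ, hf, hf', hne]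

/-- A character `χ` with values `±1` prevents divisibility: the element `∑ χ(g) u(g)` kills every
basis vector that is fixed by some `g` with `χ(g) = -1`, but no basis vector with trivial
stabilizer. -/
theorem IsPermutationBasis.not_dividesMultiple {k R M N Γ X Y : Type*} [CommRing k] [Nontrivial k]
    [Ring R] [Algebra k R] [AddCommGroup M] [Module k M] [Module R M]
    [AddCommGroup N] [Module k N] [Module R N] [IsScalarTower k R N] [Group Γ] [Finite Γ]
    [MulAction Γ X] [MulAction Γ Y] {u : Γ →* R}
    {b : Module.Basis X k M} {c : Module.Basis Y k N}
    (hb : IsPermutationBasis u b) (hc : IsPermutationBasis u c) (χ : Γ →* ℤˣ)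
    (hY : ∀ y : Y, ∃ g : Γ, χ g = -1 ∧ g • y = y) {x : X} (hx : ∀ g : Γ, g • x = x → g = 1) :
    ¬ DividesMultiple R M N := by
  intro h
  have := Fintype.ofFinite Γ
  let a : R := ∑ g, χ g • u g
  have hcy (y : Y) : a • c y = 0 := by
    obtain ⟨g₀, hχ, hg₀⟩ := hY y
    simp only [a, Finset.sum_smul, smul_assoc]
    refine sum_intUnits_smul_eq_zero χ _ hχ fun g => ?_
    rw [map_mul, mul_smul, hc g₀, hg₀]
  have haN (v : N) : a • v = 0 :=
    LinearMap.congr_fun (c.ext hcy : Algebra.lsmul k k N a = 0) v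
  have hinj : Function.Injective fun g : Γ => g • x := fun g g' hgg' =>
    inv_mul_eq_one.1 (hx _ (by rw [mul_smul, inv_smul_eq_iff]; exact hgg'.symm))
  have hlin : LinearIndependent k fun g : Γ => b (g • x) := b.linearIndependent.comp _ hinj
  have hsum : ∑ g, χ g • b (g • x) = 0 := by
    simpa only [a, Finset.sum_smul, smul_assoc, hb _ x] using h.smul_eq_zero haN (b x)
  simp only [Units.smul_def, ← Int.cast_smul_eq_zsmul k] at hsum
  exact one_ne_zero (α := k) (by simpa using Fintype.linearIndependent_iff.1 hlin _ hsum 1)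

/-! ### Tuples of points -/

section Tuples

variable (Γ : Type*) {X : Type*} [Group Γ] [MulAction Γ X]

/-- The tuple `t` is independent if none of its entries is fixed by the common stabilizer of the
other entries. The absence of long independent tuples yields upper bounds for depths. -/
def IsIndependentTuple {ι : Type*} (t : ι → X) : Prop :=
  ∀ l, ∃ g : Γ, (∀ i, i ≠ l → g • t i = t i) ∧ g • t l ≠ t l

variable (X) in
/-- The obstruction to depth `m`: a finite subgroup `K` with a character `χ : K → {±1}` such that
every tuple of at most `m` points is fixed by some `g` with `χ g = -1`, although some tuple of
`m + 1` points is fixed by `1` only. -/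
def HasSignObstruction (m : ℕ) : Prop :=
  ∃ (K : Subgroup Γ) (_ : Finite K) (χ : K →* ℤˣ),
    (∀ r ≤ m, ∀ t : Fin r → X, ∃ g : K, χ g = -1 ∧ g • t = t) ∧
    ∃ t : Fin (m + 1) → X, ∀ g : K, g • t = t → g = 1

variable {Γ}

theorem exists_stabilizer_comp_succAbove_eq {m : ℕ} {t : Fin (m + 1) → X}
    (ht : ¬ IsIndependentTuple Γ t) :
    ∃ l : Fin (m + 1), MulAction.stabilizer Γ t = MulAction.stabilizer Γ (t ∘ l.succAbove) := by
  simp only [IsIndependentTuple, not_forall, not_exists, not_and, not_not] at ht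
  obtain ⟨l, hl⟩ := ht
  refine ⟨l, SetLike.ext fun g => ?_⟩
  simp only [MulAction.mem_stabilizer_iff, funext_iff, Pi.smul_apply, Function.comp_apply]
  refine ⟨fun h i => h _, fun h => (Fin.forall_iff_succAbove l).2 ⟨hl g fun i hi => ?_, h⟩⟩
  obtain ⟨i, rfl⟩ := Fin.exists_succAbove_eq hi
  exact h i

end Tuples

/-! ### Depth of permutation modules -/

section ModuleDepth

variable {k W Γ G X : Type*} [Field k] [AddCommGroup W] [Module k W] [Group Γ] [Group G]
  [MulAction Γ X] {ρ : Representation k G W} {v : Γ →* G} {b : Module.Basis X k W}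

theorem span_range_of_comp_eq_top (hv : Function.Surjective v) :
    Submodule.span k (Set.range ((MonoidAlgebra.of k G).comp v)) = ⊤ := by
  rw [MonoidHom.coe_comp, hv.range_comp, ← (MonoidAlgebra.basis G k).span_eq]
  congr 2

theorem IsPermutationBasis.tensorPower (hb : IsPermutationBasis (ρ.comp v) b) (m : ℕ) :
    IsPermutationBasis ((tensorPowerRep ρ m).comp v)
      (Basis.piTensorProduct fun _ : Fin m => b) := by
  intro g t
  rw [Basis.piTensorProduct_apply, Basis.piTensorProduct_apply]
  exact (PiTensorProduct.map_tprod _ _).trans (congrArg _ (funext fun i => hb g (t i)))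

theorem IsPermutationBasis.asModule (hb : IsPermutationBasis (ρ.comp v) b) :
    IsPermutationBasis ((MonoidAlgebra.of k G).comp v) (b.map ρ.asModuleEquiv.symm) := by
  intro g x
  rw [Module.Basis.map_apply, Module.Basis.map_apply, ← hb g x]
  exact (ρ.asModuleEquiv_symm_map_rho (v g) (b x)).symm

theorem IsPermutationBasis.truncatedTensor (hb : IsPermutationBasis (ρ.comp v) b) (m : ℕ) :
    IsPermutationBasis ((MonoidAlgebra.of k G).comp v) (Pi.basis fun i : truncExponents m =>
      (Basis.piTensorProduct fun _ : Fin i => b).map (tensorPowerRep ρ i).asModuleEquiv.symm) :=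
  .pi fun i => (hb.tensorPower i).asModule

theorem mem_truncExponents_self (m : ℕ) : m ∈ truncExponents m := by
  unfold truncExponents; split_ifs <;> simp_all; omega

theorem le_of_mem_truncExponents {m r : ℕ} (hr : r ∈ truncExponents m) : r ≤ m := by
  unfold truncExponents at hr; split_ifs at hr <;> simp_all

theorem mem_truncExponents_or_eq_of_mem_succ {m r : ℕ} (hr : r ∈ truncExponents (m + 1)) :
    r ∈ truncExponents m ∨ r = m + 1 := by
  unfold truncExponents at *; split_ifs <;> simp_all
  all_goals omega

theorem stabilizer_sigmaMk {Γ ι : Type*} {Y : ι → Type*} [Group Γ] [∀ i, MulAction Γ (Y i)]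
    (i : ι) (y : Y i) :
    MulAction.stabilizer Γ (⟨i, y⟩ : Σ i, Y i) = MulAction.stabilizer Γ y := by
  ext g
  simp [MulAction.mem_stabilizer_iff, Sigma.smul_mk]

theorem IsPermutationBasis.hasModuleDepth [Finite X] {m : ℕ} (hv : Function.Surjective v)
    (hb : IsPermutationBasis (ρ.comp v) b)
    (hX : ∀ t : Fin (m + 1) → X, ¬ IsIndependentTuple Γ t) : HasModuleDepth ρ m := by
  refine (hb.truncatedTensor (m + 1)).dividesMultiple (span_range_of_comp_eq_top hv)
    (hb.truncatedTensor m) ?_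
  rintro ⟨⟨r, hr⟩, t⟩
  rcases mem_truncExponents_or_eq_of_mem_succ hr with hr' | rfl
  · exact ⟨⟨⟨r, hr'⟩, t⟩, by rw [stabilizer_sigmaMk, stabilizer_sigmaMk]⟩
  · obtain ⟨l, hl⟩ := exists_stabilizer_comp_succAbove_eq (hX t)
    exact ⟨⟨⟨m, mem_truncExponents_self m⟩, t ∘ l.succAbove⟩, by
      rw [stabilizer_sigmaMk, stabilizer_sigmaMk, hl]⟩

theorem HasSignObstruction.not_hasModuleDepth {m : ℕ} (hX : HasSignObstruction Γ X m)
    (hb : IsPermutationBasis (ρ.comp v) b) : ¬ HasModuleDepth ρ m := by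
  obtain ⟨K, _, χ, hodd, t, ht⟩ := hX
  refine ((hb.truncatedTensor (m + 1)).restrict K).not_dividesMultiple
    ((hb.truncatedTensor m).restrict K) χ ?_ (x := ⟨⟨m + 1, mem_truncExponents_self _⟩, t⟩) ?_
  · rintro ⟨⟨r, hr⟩, s⟩
    obtain ⟨g, hχ, hg⟩ := hodd r (le_of_mem_truncExponents hr) s
    exact ⟨g, hχ, congrArg (Sigma.mk _) hg⟩
  · exact fun g hg => ht g (eq_of_heq (Sigma.mk.inj hg).2)

theorem IsPermutationBasis.isMinModuleDepth [Finite X] {m : ℕ} (hv : Function.Surjective v)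
    (hb : IsPermutationBasis (ρ.comp v) b)
    (hupper : ∀ t : Fin (m + 1) → X, ¬ IsIndependentTuple Γ t)
    (hlower : ∀ j < m, HasSignObstruction Γ X j) : IsMinModuleDepth ρ m := by
  refine ⟨hb.hasModuleDepth hv hupper, fun j hj => ?_⟩
  by_contra! hlt
  exact (hlower j hlt).not_hasModuleDepth hb hj

end ModuleDepth

/-! ### The permutation module of a transitive action -/

theorem exists_basis_quotient {k E S T : Type*} [CommRing k] [AddCommGroup E] [Module k E]
    (e : Module.Basis S k E) {W : Submodule k E} {π : S → T} (hπ : Function.Surjective π)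
    (hker : W ≤ LinearMap.ker (e.constr k fun s => Finsupp.single (π s) (1 : k)))
    (hrel : ∀ s s', π s = π s' → e s - e s' ∈ W) :
    ∃ b : Module.Basis T k (E ⧸ W), ∀ s, b (π s) = W.mkQ (e s) := by
  let toFinsupp : (E ⧸ W) →ₗ[k] T →₀ k := W.liftQ _ hker
  let ofFinsupp : (T →₀ k) →ₗ[k] E ⧸ W :=
    Finsupp.linearCombination k fun t => W.mkQ (e (Function.surjInv hπ t))
  have hof (s : S) : ofFinsupp (Finsupp.single (π s) 1) = W.mkQ (e s) := by
    simp only [ofFinsupp, Finsupp.linearCombination_single, one_smul]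
    exact (Submodule.Quotient.eq W).2 (hrel _ _ (Function.surjInv_eq hπ _))
  have hto (s : S) : toFinsupp (W.mkQ (e s)) = Finsupp.single (π s) 1 := by
    simp [toFinsupp]
  refine ⟨.ofRepr (.ofLinearMap toFinsupp ofFinsupp ?_ ?_), hof⟩
  · refine Finsupp.basisSingleOne.ext fun t => ?_
    obtain ⟨s, rfl⟩ := hπ t
    simp only [LinearMap.comp_apply, Finsupp.coe_basisSingleOne, hto, hof, LinearMap.id_apply]
  · refine Submodule.linearMap_qext _ (e.ext fun s => ?_)
    simp only [LinearMap.comp_apply, hto, hof, LinearMap.id_apply]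

/-- The group algebra of `H` as a subalgebra of that of `G`, for a homomorphism `ι : H →* G`. -/
noncomputable def groupSubalgebra (k : Type*) {H G : Type*} [CommSemiring k] [Group H]
    [Group G] (ι : H →* G) : Subalgebra k (MonoidAlgebra k G) :=
  (MonoidAlgebra.mapDomainAlgHom k k ι).range

section PermutationModule

theorem toSubmodule_groupSubalgebra {k H G : Type*} [CommRing k] [Group H] [Group G] (ι : H →* G) :
    Subalgebra.toSubmodule (groupSubalgebra k ι) =
      Submodule.span k (Set.range fun h => MonoidAlgebra.of k G (ι h)) := by
  change LinearMap.range (MonoidAlgebra.mapDomainAlgHom k k ι).toLinearMap = _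
  rw [LinearMap.range_eq_map, ← (MonoidAlgebra.basis H k).span_eq, Submodule.map_span,
    ← Set.range_comp]
  congr 2
  ext1 h
  simp

variable {k G H X : Type*} [Field k] [Group G] [Group H] [MulAction G X] {ι : H →* G}
  {x₀ : X}

theorem of_mem_groupSubalgebra (h : H) : MonoidAlgebra.of k G (ι h) ∈ groupSubalgebra k ι :=
  ⟨MonoidAlgebra.of k H h, by simp⟩

theorem map_mul_of_mem_groupSubalgebra {N : Type*} [AddCommGroup N] [Module k N]
    {L : MonoidAlgebra k G →ₗ[k] N}
    (hL : ∀ h g, L (MonoidAlgebra.of k G (ι h * g)) = L (MonoidAlgebra.of k G g))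
    {r : MonoidAlgebra k G} (hr : r ∈ groupSubalgebra k ι) (x : MonoidAlgebra k G) :
    L (r * x) = (Coalgebra.counit r : k) • L x := by
  rw [← Subalgebra.mem_toSubmodule, toSubmodule_groupSubalgebra] at hr
  induction hr using Submodule.span_induction with
  | mem r hr =>
    obtain ⟨h, rfl⟩ := hr
    have hLh : L ∘ₗ LinearMap.mulLeft k (MonoidAlgebra.of k G (ι h)) = L :=
      (MonoidAlgebra.basis G k).ext fun g => by simpa using hL h g
    simpa using LinearMap.congr_fun hLh x
  | zero => simp
  | add r s _ _ hr hs => rw [add_mul, map_add, hr, hs, map_add, add_smul]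
  | smul c r _ hr => rw [smul_mul_assoc, map_smul, hr, map_smul, smul_assoc]

theorem augmentationMul_le_ker (hι : ∀ h, ι h • x₀ = x₀) :
    augmentationMul (groupSubalgebra k ι) ≤ LinearMap.ker
      ((MonoidAlgebra.basis G k).constr k fun g => Finsupp.single (g⁻¹ • x₀) (1 : k)) := by
  set L := (MonoidAlgebra.basis G k).constr k fun g => Finsupp.single (g⁻¹ • x₀) (1 : k)
  have hL (g : G) : L (MonoidAlgebra.of k G g) = Finsupp.single (g⁻¹ • x₀) 1 := by
    rw [MonoidAlgebra.of_apply, ← MonoidAlgebra.basis_apply, Module.Basis.constr_basis]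
  refine Submodule.mul_le.2 fun r hr x _ => ?_
  have hcounit : (Coalgebra.counit r : k) = 0 := hr.2
  rw [LinearMap.mem_ker, map_mul_of_mem_groupSubalgebra (fun h g => ?_) hr.1, hcounit, zero_smul]
  rw [hL, hL, mul_inv_rev, mul_smul, inv_smul_eq_iff.2 (hι h).symm]

theorem of_sub_of_mem_augmentationMul (h : H) (g : G) :
    MonoidAlgebra.of k G (ι h * g) - MonoidAlgebra.of k G g ∈
      augmentationMul (groupSubalgebra k ι) := by
  have hmul : MonoidAlgebra.of k G (ι h * g) - MonoidAlgebra.of k G g =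
      (MonoidAlgebra.of k G (ι h) - 1) * MonoidAlgebra.of k G g := by
    rw [map_mul, sub_mul, one_mul]
  rw [hmul]
  refine Submodule.mul_mem_mul ⟨(groupSubalgebra k ι).sub_mem (of_mem_groupSubalgebra h)
    (one_mem _), LinearMap.mem_ker.2 ?_⟩ Submodule.mem_top
  simp [MonoidAlgebra.one_def]

theorem permutationModule_mkQ (R : Subalgebra k (MonoidAlgebra k G)) (g : Gᵐᵒᵖ)
    (x : MonoidAlgebra k G) :
    permutationModule R g ((augmentationMul R).mkQ x) =
      (augmentationMul R).mkQ (x * MonoidAlgebra.of k G g.unop) :=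
  rfl

theorem exists_isPermutationBasis_permutationModule [MulAction.IsPretransitive G X]
    (hι : ι.range = MulAction.stabilizer G x₀) :
    ∃ b : Module.Basis X k (MonoidAlgebra k G ⧸ augmentationMul (groupSubalgebra k ι)),
      IsPermutationBasis
        ((permutationModule (groupSubalgebra k ι)).comp (MulEquiv.inv' G).toMonoidHom) b := by
  have hπ (x : X) : ∃ g : G, g⁻¹ • x₀ = x := by
    obtain ⟨g, rfl⟩ := MulAction.exists_smul_eq G x₀ x
    exact ⟨g⁻¹, by rw [inv_inv]⟩
  obtain ⟨b, hb⟩ := exists_basis_quotient (MonoidAlgebra.basis G k) hπ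
    (augmentationMul_le_ker fun h => hι.le ⟨h, rfl⟩) fun g g' hgg' => by
      have hstab : g * g'⁻¹ ∈ MulAction.stabilizer G x₀ := by
        rw [MulAction.mem_stabilizer_iff, mul_smul, ← hgg', smul_inv_smul]
      obtain ⟨h, hh⟩ := hι.ge hstab
      simpa [hh] using of_sub_of_mem_augmentationMul (k := k) (ι := ι) h g'
  refine ⟨b, fun g x => ?_⟩
  obtain ⟨a, rfl⟩ := hπ x
  have hga : g • a⁻¹ • x₀ = (a * g⁻¹)⁻¹ • x₀ := by rw [mul_inv_rev, inv_inv, mul_smul]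
  rw [hga, hb, hb]
  refine (permutationModule_mkQ _ _ _).trans (congrArg _ ?_)
  simp

theorem IsPermutationBasis.comp_op {W : Type*} [AddCommGroup W] [Module k W] [MulAction H X]
    {ρ : Representation k Gᵐᵒᵖ W} {b : Module.Basis X k W}
    (hb : IsPermutationBasis (ρ.comp (MulEquiv.inv' G).toMonoidHom) b)
    (hι : ∀ (h : H) (x : X), h • x = ι h • x) :
    IsPermutationBasis
      ((ρ.comp (MonoidHom.op ι)).comp (MulEquiv.inv' H).toMonoidHom) b := by
  intro h x
  rw [hι, ← hb (ι h) x]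
  simp

end PermutationModule

/-! ### Tensor powers of a group algebra over the group algebra of a stabilizer -/

section PartialProducts

variable {G : Type*} [Group G] {j : ℕ}

/-- A tuple of group elements corresponds to its partial products, from which it is recovered as
the tuple of successive quotients. Partial products are the convenient coordinates on
`A ⊗_B ⋯ ⊗_B A`: moving an element of `B` across a sign `⊗_B` changes only one of them. -/
def quotientsEquiv (G : Type*) [Group G] (j : ℕ) : (Fin (j + 1) → G) ≃ (Fin (j + 1) → G) where
  toFun p := Fin.cons (p 0) fun i => (p i.castSucc)⁻¹ * p i.succ
  invFun d i := Fin.partialProd d i.succ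
  left_inv p := funext fun i => by
    dsimp only
    rw [Fin.partialProd_succ', Fin.tail_cons]
    exact congrFun (Fin.partialProd_left_inv p) i
  right_inv d := funext <| Fin.cases
    ((Fin.partialProd_succ d 0).trans (by simp)) fun i => by
    dsimp only
    rw [Fin.cons_succ, Fin.succ_castSucc, Fin.partialProd_right_inv]

theorem quotientsEquiv_zero (p : Fin (j + 1) → G) : quotientsEquiv G j p 0 = p 0 :=
  rfl

theorem quotientsEquiv_succ (p : Fin (j + 1) → G) (i : Fin j) :
    quotientsEquiv G j p i.succ = (p i.castSucc)⁻¹ * p i.succ :=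
  rfl

theorem quotientsEquiv_update_apply (p : Fin (j + 1) → G) (i l : Fin (j + 1)) (c : G) :
    quotientsEquiv G j (Function.update p i (p i * c)) l =
      if l = i then quotientsEquiv G j p l * c
      else if (l : ℕ) = i + 1 then c⁻¹ * quotientsEquiv G j p l else quotientsEquiv G j p l := by
  cases l using Fin.cases with
  | zero => grind [quotientsEquiv_zero, Function.update_apply]
  | succ l =>
    have hl : (l.succ : Fin (j + 1)) ≠ l.castSucc := l.castSucc_lt_succ.ne'
    have hi : (l.succ : ℕ) = i + 1 ↔ l.castSucc = i := by
      simp [Fin.ext_iff]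
    simp only [quotientsEquiv_succ, Function.update_apply, hi]
    by_cases h1 : l.succ = i
    · subst h1
      simp [hl.symm, mul_assoc]
    · by_cases h2 : l.castSucc = i
      · subst h2
        simp [h1, mul_assoc]
      · simp [h1, h2]

theorem quotientsEquiv_update_castSucc (p : Fin (j + 1) → G) (i : Fin j) (c : G) :
    quotientsEquiv G j (Function.update p i.castSucc (p i.castSucc * c)) =
      Function.update
        (Function.update (quotientsEquiv G j p) i.succ (c⁻¹ * quotientsEquiv G j p i.succ))
        i.castSucc (quotientsEquiv G j p i.castSucc * c) := by
  funext l
  have hl : (l : ℕ) = i.castSucc + 1 ↔ l = i.succ := by simp [Fin.ext_iff]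
  rw [quotientsEquiv_update_apply]
  simp only [Function.update_apply, hl]
  grind

theorem quotientsEquiv_mul_left (p : Fin (j + 1) → G) (a : G) :
    quotientsEquiv G j (fun i => a * p i) =
      Function.update (quotientsEquiv G j p) 0 (a * quotientsEquiv G j p 0) := by
  funext l
  cases l using Fin.cases <;> simp [quotientsEquiv_zero, quotientsEquiv_succ, mul_assoc]

theorem quotientsEquiv_update_last (p : Fin (j + 1) → G) (a : G) :
    quotientsEquiv G j (Function.update p (Fin.last j) (p (Fin.last j) * a)) =
      Function.update (quotientsEquiv G j p) (Fin.last j)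
        (quotientsEquiv G j p (Fin.last j) * a) := by
  funext l
  rw [quotientsEquiv_update_apply, Function.update_apply, Fin.val_last, if_neg l.isLt.ne]
  grind

end PartialProducts

section BalancedPower

variable {k A : Type*} [Field k] [Ring A] [Algebra k A]

theorem BalancedPower.tmul_smul {B : Subalgebra k A} {j : ℕ} (a : A) (c : Aᵐᵒᵖ)
    (z : BalancedPower B j) : (a ⊗ₜ[k] c) • z = leftMul B j a (rightMul B j c.unop z) := by
  change Algebra.TensorProduct.lift (leftAct B j) (rightAct B j)
    (leftAct_commute_rightAct B j) (a ⊗ₜ[k] c) z = _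
  rw [Algebra.TensorProduct.lift_tmul]
  rfl

instance (B : Subalgebra k A) (j : ℕ) : IsScalarTower k (A ⊗[k] Aᵐᵒᵖ) (BalancedPower B j) where
  smul_assoc c s z :=
    LinearMap.congr_fun (map_smul (Algebra.TensorProduct.lift (leftAct B j) (rightAct B j)
      (leftAct_commute_rightAct B j)) c s) z

end BalancedPower

section GroupTensorBasis

variable (k G : Type*) [Field k] [Group G] (j : ℕ)

/-- The basis of `k[G] ⊗ ⋯ ⊗ k[G]` consisting of the tensors of group elements, indexed by the
partial products of the entries. -/
noncomputable def groupTensorBasis :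
    Module.Basis (Fin (j + 1) → G) k (⨂[k]^(j + 1) (MonoidAlgebra k G)) :=
  (Basis.piTensorProduct fun _ => MonoidAlgebra.basis G k).reindex (quotientsEquiv G j).symm

variable {k G j}

theorem groupTensorBasis_apply (p : Fin (j + 1) → G) :
    groupTensorBasis k G j p =
      PiTensorProduct.tprod k (MonoidAlgebra.of k G ∘ quotientsEquiv G j p) := by
  rw [groupTensorBasis, Module.Basis.reindex_apply, Equiv.symm_symm, Basis.piTensorProduct_apply]
  rfl

variable {H N : Type*} [Group H] {ι : H →* G} [AddCommGroup N] [Module k N]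

theorem comp_actAt_eq_of_groupTensorBasis {L : (⨂[k]^(j + 1) (MonoidAlgebra k G)) →ₗ[k] N}
    {i : Fin j} {c : G}
    (hL : ∀ p : Fin (j + 1) → G,
      L (groupTensorBasis k G j (Function.update p i.castSucc (p i.castSucc * c))) =
        L (groupTensorBasis k G j p)) :
    L ∘ₗ actAt j i.castSucc (LinearMap.mulRight k (MonoidAlgebra.of k G c)) =
      L ∘ₗ actAt j i.succ (LinearMap.mulLeft k (MonoidAlgebra.of k G c)) := by
  refine (groupTensorBasis k G j).ext fun p => ?_
  let p' := (quotientsEquiv G j).symm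
    (Function.update (quotientsEquiv G j p) i.succ (c * quotientsEquiv G j p i.succ))
  have hp' : quotientsEquiv G j p' =
      Function.update (quotientsEquiv G j p) i.succ (c * quotientsEquiv G j p i.succ) :=
    Equiv.apply_symm_apply _ _
  have hLp' := hL p'
  rw [groupTensorBasis_apply, groupTensorBasis_apply, quotientsEquiv_update_castSucc, hp',
    Function.update_self, inv_mul_cancel_left, Function.update_idem, Function.update_eq_self,
    Function.update_of_ne i.castSucc_lt_succ.ne, Function.comp_update, Function.comp_update,
    map_mul, map_mul] at hLp'
  rw [LinearMap.comp_apply, LinearMap.comp_apply, groupTensorBasis_apply, actAt_tprod, actAt_tprod]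
  exact hLp'

theorem balancedRel_le_ker_iff {L : (⨂[k]^(j + 1) (MonoidAlgebra k G)) →ₗ[k] N} :
    balancedRel (groupSubalgebra k ι) j ≤ LinearMap.ker L ↔
      ∀ (p : Fin (j + 1) → G) (i : Fin j) (h : H),
        L (groupTensorBasis k G j (Function.update p i.castSucc (p i.castSucc * ι h))) =
          L (groupTensorBasis k G j p) := by
  constructor
  · intro hL p i h
    have hrel := hL (Submodule.subset_span ⟨MonoidAlgebra.of k G ∘ Function.update
      (quotientsEquiv G j p) i.succ ((ι h)⁻¹ * quotientsEquiv G j p i.succ), i,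
      MonoidAlgebra.of k G (ι h), of_mem_groupSubalgebra h, rfl⟩)
    rw [LinearMap.mem_ker, map_sub, sub_eq_zero] at hrel
    rw [Function.comp_apply, Function.comp_apply, ← map_mul, ← map_mul, ← Function.comp_update,
      ← Function.comp_update, Function.update_self, mul_inv_cancel_left, Function.update_idem,
      Function.update_eq_self, Function.update_of_ne i.castSucc_lt_succ.ne] at hrel
    rwa [groupTensorBasis_apply, groupTensorBasis_apply, quotientsEquiv_update_castSucc]
  · intro hL
    refine Submodule.span_le.2 ?_
    rintro _ ⟨x, i, b, hb, rfl⟩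
    have hB : Subalgebra.toSubmodule (groupSubalgebra k ι) ≤ LinearMap.eqLocus
        (L ∘ₗ (PiTensorProduct.tprod k).toLinearMap x i.castSucc ∘ₗ
          LinearMap.mulLeft k (x i.castSucc))
        (L ∘ₗ (PiTensorProduct.tprod k).toLinearMap x i.succ ∘ₗ
          LinearMap.mulRight k (x i.succ)) := by
      rw [toSubmodule_groupSubalgebra, Submodule.span_le]
      rintro _ ⟨h, rfl⟩
      have hact := LinearMap.congr_fun
        (comp_actAt_eq_of_groupTensorBasis fun p => hL p i h) (PiTensorProduct.tprod k x)
      rwa [LinearMap.comp_apply, LinearMap.comp_apply, actAt_tprod, actAt_tprod] at hact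
    rw [SetLike.mem_coe, LinearMap.mem_ker, map_sub, sub_eq_zero]
    exact hB hb

end GroupTensorBasis

section BimoduleBasis

/-- The indices of a basis of `k[G] ⊗_{k[H]} ⋯ ⊗_{k[H]} k[G]` (with `j` signs `⊗`), where
`X = G / H`: the cosets of the partial products but the last, and the last partial product. -/
@[ext]
structure BalancedIndex (G X : Type*) (j : ℕ) where
  /-- The cosets of the partial products but the last. -/
  cosets : Fin j → X
  /-- The product of all entries. -/
  product : G

variable {G X : Type*} [Group G] [MulAction G X] {j : ℕ}

namespace BalancedIndex

instance : MulAction (G × G) (BalancedIndex G X j) where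
  smul g x := ⟨g.1 • x.cosets, g.1 * x.product * g.2⁻¹⟩
  one_smul x := BalancedIndex.ext (one_smul _ _) (by change 1 * x.2 * 1⁻¹ = x.2; simp)
  mul_smul g g' x := BalancedIndex.ext (mul_smul _ _ _) (by
    change g.1 * g'.1 * x.2 * (g.2 * g'.2)⁻¹ = g.1 * (g'.1 * x.2 * g'.2⁻¹) * g.2⁻¹
    group)

theorem smul_def (g : G × G) (x : BalancedIndex G X j) :
    g • x = ⟨g.1 • x.cosets, g.1 * x.product * g.2⁻¹⟩ :=
  rfl

instance [Finite X] : Finite (MulAction.orbitRel.Quotient (G × G) (BalancedIndex G X j)) :=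
  Finite.of_surjective (fun t : Fin j → X => Quotient.mk _ (⟨t, 1⟩ : BalancedIndex G X j)) <| by
    refine Quotient.ind fun ⟨t, g⟩ => ⟨t, Quotient.sound ⟨(1, g), ?_⟩⟩
    dsimp only
    rw [smul_def, one_smul, one_mul, mul_inv_cancel]

/-- The index of the basis vector represented by the tensor with partial products `p`. -/
def ofPartialProducts (x₀ : X) (p : Fin (j + 1) → G) : BalancedIndex G X j :=
  ⟨fun i => p i.castSucc • x₀, p (Fin.last j)⟩

variable {x₀ : X}

theorem ofPartialProducts_surjective [MulAction.IsPretransitive G X] :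
    Function.Surjective (ofPartialProducts x₀ : (Fin (j + 1) → G) → BalancedIndex G X j) := by
  rintro ⟨t, g⟩
  choose q hq using fun i => MulAction.exists_smul_eq G x₀ (t i)
  exact ⟨Fin.snoc q g, BalancedIndex.ext (funext fun i => by simp [ofPartialProducts, hq])
    (by simp [ofPartialProducts])⟩

theorem smul_ofPartialProducts (g : G × G) (p : Fin (j + 1) → G) :
    g • ofPartialProducts x₀ p = ofPartialProducts x₀ fun i =>
      g.1 * Function.update p (Fin.last j) (p (Fin.last j) * g.2⁻¹) i := by
  rw [smul_def]
  refine BalancedIndex.ext (funext fun i => ?_) ?_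
  · simp [ofPartialProducts, mul_smul]
  · simp [ofPartialProducts, mul_assoc]

theorem ofPartialProducts_update_castSucc {s : G} (hs : s • x₀ = x₀) (p : Fin (j + 1) → G)
    (i : Fin j) :
    ofPartialProducts x₀ (Function.update p i.castSucc (p i.castSucc * s)) =
      ofPartialProducts x₀ p := by
  refine BalancedIndex.ext (funext fun l => ?_) (Function.update_of_ne i.castSucc_lt_last.ne' _ _)
  rcases eq_or_ne l i with rfl | hl
  · simp [ofPartialProducts, mul_smul, hs]
  · simp [ofPartialProducts, hl]

theorem stabilizer_congr {j' : ℕ} {t : Fin j → X} {t' : Fin j' → X}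
    (h : MulAction.stabilizer G t = MulAction.stabilizer G t') (g : G) :
    MulAction.stabilizer (G × G) (⟨t, g⟩ : BalancedIndex G X j) =
      MulAction.stabilizer (G × G) (⟨t', g⟩ : BalancedIndex G X j') := by
  ext a
  have ha : a.1 • t = t ↔ a.1 • t' = t' := SetLike.ext_iff.1 h a.1
  simp only [MulAction.mem_stabilizer_iff, smul_def, BalancedIndex.ext_iff, ha]

end BalancedIndex

/-- `(a, c)` acts on a `k[G]`-`k[G]`-bimodule by `z ↦ a z c⁻¹`. -/
noncomputable def bimoduleHom (k G : Type*) [Field k] [Group G] :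
    G × G →* MonoidAlgebra k G ⊗[k] (MonoidAlgebra k G)ᵐᵒᵖ where
  toFun g := MonoidAlgebra.of k G g.1 ⊗ₜ MulOpposite.op (MonoidAlgebra.of k G g.2⁻¹)
  map_one' := by
    rw [Prod.fst_one, Prod.snd_one, inv_one, map_one]
    rfl
  map_mul' g g' := by
    rw [Algebra.TensorProduct.tmul_mul_tmul, ← MulOpposite.op_mul, ← map_mul, ← map_mul,
      ← mul_inv_rev]
    rfl

theorem span_range_bimoduleHom (k G : Type*) [Field k] [Group G] :
    Submodule.span k (Set.range (bimoduleHom k G)) = ⊤ := by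
  let e := (MonoidAlgebra.basis G k).tensorProduct
    ((MonoidAlgebra.basis G k).map (MulOpposite.opLinearEquiv k))
  have he : ⇑(bimoduleHom k G) = e ∘ Prod.map id Inv.inv := funext fun ⟨a, c⟩ => by
    simp [e, bimoduleHom]
  rw [he, (Function.surjective_id.prodMap inv_surjective).range_comp, e.span_eq]

theorem eq_of_forall_update_eq {ι α β : Type*} [Finite ι] [DecidableEq ι] (f : (ι → α) → β)
    {q q' : ι → α} (h : ∀ r i, r i = q i → f (Function.update r i (q' i)) = f r) :
    f q = f q' := by
  have := Fintype.ofFinite ι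
  have hs (s : Finset ι) : f (s.piecewise q' q) = f q := by
    induction s using Finset.induction with
    | empty => rw [Finset.piecewise_empty]
    | insert i s hi ih =>
      rw [Finset.piecewise_insert, h _ _ (Finset.piecewise_eq_of_notMem _ _ _ hi), ih]
  rw [← hs Finset.univ, Finset.piecewise_univ]

variable {k H : Type*} [Field k] [Group H] {ι : H →* G} {x₀ : X}

theorem mkQ_groupTensorBasis_eq (hι : MulAction.stabilizer G x₀ ≤ ι.range)
    {p p' : Fin (j + 1) → G} (h : BalancedIndex.ofPartialProducts x₀ p = .ofPartialProducts x₀ p') :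
    (balancedRel (groupSubalgebra k ι) j).mkQ (groupTensorBasis k G j p) =
      (balancedRel (groupSubalgebra k ι) j).mkQ (groupTensorBasis k G j p') := by
  obtain ⟨hX, hG⟩ := BalancedIndex.mk.inj h
  refine eq_of_forall_update_eq
    (fun p => (balancedRel (groupSubalgebra k ι) j).mkQ (groupTensorBasis k G j p)) fun r i hr => ?_
  cases i using Fin.lastCases with
  | last => rw [← hG, ← hr, Function.update_eq_self]
  | cast i =>
    have hstab : (p i.castSucc)⁻¹ * p' i.castSucc ∈ MulAction.stabilizer G x₀ := by
      rw [MulAction.mem_stabilizer_iff, mul_smul, inv_smul_eq_iff]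
      exact (congrFun hX i).symm
    obtain ⟨s, hs⟩ := hι hstab
    have hp' : p' i.castSucc = r i.castSucc * ι s := by rw [hs, hr, mul_inv_cancel_left]
    rw [hp']
    exact balancedRel_le_ker_iff.1 (Submodule.ker_mkQ _).ge r i s

theorem bimoduleHom_smul_mk (B : Subalgebra k (MonoidAlgebra k G)) (g : G × G)
    (p : Fin (j + 1) → G) :
    bimoduleHom k G g • BalancedPower.mk B j (MonoidAlgebra.of k G ∘ quotientsEquiv G j p) =
      BalancedPower.mk B j (MonoidAlgebra.of k G ∘ quotientsEquiv G j fun i =>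
        g.1 * Function.update p (Fin.last j) (p (Fin.last j) * g.2⁻¹) i) := by
  have hright : rightMul B j (MonoidAlgebra.of k G g.2⁻¹)
      (.mk B j (MonoidAlgebra.of k G ∘ quotientsEquiv G j p)) =
      .mk B j (MonoidAlgebra.of k G ∘ quotientsEquiv G j
        (Function.update p (Fin.last j) (p (Fin.last j) * g.2⁻¹))) := by
    rw [rightMul_mk, quotientsEquiv_update_last, Function.comp_update, map_mul,
      Function.comp_apply]
  refine (BalancedPower.tmul_smul _ _ _).trans ?_
  rw [MulOpposite.unop_op, hright, leftMul_mk, quotientsEquiv_mul_left, Function.comp_update,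
    map_mul, Function.comp_apply]

theorem exists_isPermutationBasis_balancedPower [MulAction.IsPretransitive G X]
    (hι : ι.range = MulAction.stabilizer G x₀) (j : ℕ) :
    ∃ b : Module.Basis (BalancedIndex G X j) k (BalancedPower (groupSubalgebra k ι) j),
      IsPermutationBasis (bimoduleHom k G) b := by
  obtain ⟨b, hb⟩ := exists_basis_quotient (groupTensorBasis k G j)
    (BalancedIndex.ofPartialProducts_surjective (x₀ := x₀))
    (balancedRel_le_ker_iff (ι := ι).2 fun p i h => by
      rw [Module.Basis.constr_basis, Module.Basis.constr_basis,
        BalancedIndex.ofPartialProducts_update_castSucc (hι.le ⟨h, rfl⟩)])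
    fun p p' h => (Submodule.Quotient.eq _).1 (mkQ_groupTensorBasis_eq hι.ge h)
  have hb' (p : Fin (j + 1) → G) : b (.ofPartialProducts x₀ p) =
      BalancedPower.mk _ j (MonoidAlgebra.of k G ∘ quotientsEquiv G j p) := by
    rw [hb, groupTensorBasis_apply, BalancedPower.mk]
  refine ⟨b, fun g x => ?_⟩
  obtain ⟨p, rfl⟩ := BalancedIndex.ofPartialProducts_surjective (x₀ := x₀) x
  rw [BalancedIndex.smul_ofPartialProducts]
  exact (congrArg _ (hb' p)).trans ((bimoduleHom_smul_mk _ g p).trans (hb' _).symm)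

end BimoduleBasis

/-! ### H-depth of the group algebra of a stabilizer -/

section HDepth

variable {k G H X : Type*} [Field k] [Group G] [Group H] [MulAction G X] {ι : H →* G} {x₀ : X}

theorem exists_stabilizer_eq_of_forall_not_isIndependentTuple [Nonempty X] {j : ℕ}
    (hX : ∀ t : Fin (j + 1) → X, ¬ IsIndependentTuple G t) (t : Fin j → X) :
    ∃ t' : Fin (j + 1) → X, MulAction.stabilizer G t = MulAction.stabilizer G t' := by
  cases j with
  | zero =>
    obtain ⟨x⟩ := ‹Nonempty X›
    obtain ⟨l, hl⟩ := exists_stabilizer_comp_succAbove_eq (hX fun _ => x)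
    exact ⟨_, by rw [hl, Subsingleton.elim t]⟩
  | succ j =>
    refine ⟨Fin.cons (t 0) t, SetLike.ext fun g => ?_⟩
    simp only [MulAction.mem_stabilizer_iff, funext_iff, Pi.smul_apply,
      Fin.forall_fin_succ (n := j + 1), Fin.cons_zero, Fin.cons_succ]
    exact ⟨fun h => ⟨h 0, h⟩, And.right⟩

theorem hasHDepth_groupSubalgebra [Finite X] [MulAction.IsPretransitive G X]
    (hι : ι.range = MulAction.stabilizer G x₀) {j : ℕ}
    (hX : ∀ t : Fin (j + 1) → X, ¬ IsIndependentTuple G t) :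
    HasHDepth (groupSubalgebra k ι) (2 * j + 1) := by
  have : Nonempty X := ⟨x₀⟩
  obtain ⟨b, hb⟩ := exists_isPermutationBasis_balancedPower (k := k) hι j
  obtain ⟨b', hb'⟩ := exists_isPermutationBasis_balancedPower (k := k) hι (j + 1)
  refine ⟨j, rfl, hb'.dividesMultiple (span_range_bimoduleHom k G) hb ?_,
    hb.dividesMultiple (span_range_bimoduleHom k G) hb' ?_⟩
  · rintro ⟨t, g⟩
    obtain ⟨l, hl⟩ := exists_stabilizer_comp_succAbove_eq (hX t)
    exact ⟨⟨t ∘ l.succAbove, g⟩, BalancedIndex.stabilizer_congr hl g⟩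
  · rintro ⟨t, g⟩
    obtain ⟨t', ht'⟩ := exists_stabilizer_eq_of_forall_not_isIndependentTuple hX t
    exact ⟨⟨t', g⟩, BalancedIndex.stabilizer_congr ht' g⟩

theorem HasSignObstruction.not_dividesMultiple_balancedPower [Finite G]
    [MulAction.IsPretransitive G X] (hι : ι.range = MulAction.stabilizer G x₀) {j : ℕ}
    (hX : HasSignObstruction G X j) :
    ¬ DividesMultiple (MonoidAlgebra k G ⊗[k] (MonoidAlgebra k G)ᵐᵒᵖ)
      (BalancedPower (groupSubalgebra k ι) (j + 1)) (BalancedPower (groupSubalgebra k ι) j) := by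
  obtain ⟨K, _, χ, hodd, t, ht⟩ := hX
  obtain ⟨b, hb⟩ := exists_isPermutationBasis_balancedPower (k := k) hι j
  obtain ⟨b', hb'⟩ := exists_isPermutationBasis_balancedPower (k := k) hι (j + 1)
  let fst : K.prod (⊤ : Subgroup G) →* K :=
    ((MonoidHom.fst G G).comp (K.prod ⊤).subtype).codRestrict K fun g => g.2.1
  refine (hb'.restrict (K.prod ⊤)).not_dividesMultiple (hb.restrict (K.prod ⊤)) (χ.comp fst)
    (x := ⟨t, 1⟩) ?_ ?_
  · rintro ⟨s, g⟩
    obtain ⟨σ, hχ, hσ⟩ := hodd j le_rfl s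
    refine ⟨⟨(σ, g⁻¹ * σ * g), σ.2, Subgroup.mem_top _⟩, hχ, BalancedIndex.ext hσ ?_⟩
    change ↑σ * g * (g⁻¹ * σ * g)⁻¹ = g
    group
  · rintro ⟨⟨σ, a⟩, hσ, _⟩ hfix
    obtain ⟨hσt, hσa⟩ := BalancedIndex.mk.inj hfix
    have hσ1 : σ = 1 := congrArg Subtype.val (ht ⟨σ, hσ⟩ hσt)
    subst hσ1
    exact Subtype.ext (Prod.ext rfl (by simpa using hσa))

theorem isMinHDepth_groupSubalgebra [Finite G] [MulAction.IsPretransitive G X]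
    (hι : ι.range = MulAction.stabilizer G x₀) {m : ℕ}
    (hupper : ∀ t : Fin (m + 1) → X, ¬ IsIndependentTuple G t)
    (hlower : ∀ j < m, HasSignObstruction G X j) :
    IsMinHDepth (groupSubalgebra k ι) (2 * m + 1) := by
  have : Finite X := .of_surjective (· • x₀) (MulAction.surjective_smul G x₀)
  refine ⟨hasHDepth_groupSubalgebra hι hupper, ?_⟩
  rintro _ ⟨j, rfl, hj, _⟩
  by_contra! hlt
  exact (hlower j (by omega)).not_dividesMultiple_balancedPower hι hj

end HDepth

/-! ### Permutation actions of symmetric groups -/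

section Perm

variable {α X : Type*}

theorem perm_eq_one_of_forall_ne {σ : Equiv.Perm α} (a : α) (h : ∀ b, b ≠ a → σ b = b) : σ = 1 := by
  have ha : σ a = a := by
    by_contra hne
    exact hne (σ.injective (h _ hne))
  exact Equiv.ext fun b => (eq_or_ne b a).elim (fun hb => hb ▸ ha) (h b)

variable [Fintype α] [MulAction (Equiv.Perm α) X]

/- The entries of an independent tuple would be distinct points of `α`, hence all of them, but a
permutation fixing all points except one fixes that one as well. -/
theorem not_isIndependentTuple_of_card_le {i : α →[Equiv.Perm α] X} (hi : Function.Injective i)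
    (hfix : ∀ x ∉ Set.range i, ∀ σ : Equiv.Perm α, σ • x = x) {m : ℕ}
    (hm : Fintype.card α ≤ m + 1) (t : Fin (m + 1) → X) :
    ¬ IsIndependentTuple (Equiv.Perm α) t := by
  intro ht
  have hrange (l : Fin (m + 1)) : t l ∈ Set.range i := by
    obtain ⟨σ, -, hσ⟩ := ht l
    exact not_imp_comm.1 (hfix (t l)) fun h => hσ (h σ)
  choose a ha using hrange
  have ha_inj : Function.Injective a := by
    intro l l' hll'
    by_contra hne
    obtain ⟨σ, hσ, hσl⟩ := ht l
    rw [← ha l, hll', ha l'] at hσl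
    exact hσl (hσ l' (Ne.symm hne))
  have ha_surj : Function.Surjective a := ((Fintype.bijective_iff_injective_and_card a).2
    ⟨ha_inj, le_antisymm (Fintype.card_le_of_injective a ha_inj) (by simpa using hm)⟩).2
  obtain ⟨σ, hσ, hσ0⟩ := ht 0
  have hσ1 : σ = 1 := perm_eq_one_of_forall_ne (a 0) fun b hb => by
    obtain ⟨l, rfl⟩ := ha_surj b
    have hl := hσ l fun h => hb (congrArg a h)
    rw [← ha l, ← map_smul] at hl
    exact hi hl
  exact hσ0 (hσ1 ▸ one_smul _ _)

theorem exists_ne_notMem_range {β γ : Type*} {f : β → γ} (hf : Function.Injective f) [Fintype β]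
    {r : ℕ} (hr : r + 2 ≤ Fintype.card β) (t : Fin r → γ) :
    ∃ p q, p ≠ q ∧ f p ∉ Set.range t ∧ f q ∉ Set.range t := by
  classical
  have hcard : 1 < (Finset.univ.image f \ Finset.univ.image t).card := by
    have hsdiff := Finset.le_card_sdiff (Finset.univ.image t) (Finset.univ.image f)
    have ht : (Finset.univ.image t).card ≤ r := Finset.card_image_le.trans_eq (Finset.card_fin r)
    rw [Finset.card_image_of_injective _ hf, Finset.card_univ] at hsdiff
    omega
  obtain ⟨x, hx, y, hy, hxy⟩ := Finset.one_lt_card.1 hcard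
  simp only [Finset.mem_sdiff, Finset.mem_image, Finset.mem_univ, true_and] at hx hy
  obtain ⟨⟨p, rfl⟩, hp⟩ := hx
  obtain ⟨⟨q, rfl⟩, hq⟩ := hy
  exact ⟨p, q, fun h => hxy (congrArg f h), hp, hq⟩

theorem hasSignObstruction_of_le_card {i : α →[Equiv.Perm α] X} (hi : Function.Injective i)
    (hfix : ∀ x ∉ Set.range i, ∀ σ : Equiv.Perm α, σ • x = x) {m : ℕ}
    (hm : m + 2 ≤ Fintype.card α) : HasSignObstruction (Equiv.Perm α) X m := by
  classical
  obtain ⟨f⟩ : Nonempty (Fin (m + 2) ↪ α) := Function.Embedding.nonempty_of_card_le (by simpa)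
  refine ⟨fixingSubgroup (Equiv.Perm α) (Set.range f)ᶜ, inferInstance,
    Equiv.Perm.sign.comp (Subgroup.subtype _), fun r hr t => ?_, fun l => i (f l.castSucc),
    fun ⟨σ, hσ⟩ hσt => ?_⟩
  · obtain ⟨p, q, hpq, hp, hq⟩ := exists_ne_notMem_range (hi.comp f.injective)
      (by simpa using Nat.add_le_add_right hr 2) t
    refine ⟨⟨Equiv.swap (f p) (f q), (mem_fixingSubgroup_iff _).2 fun b hb => ?_⟩,
      Equiv.Perm.sign_swap (f.injective.ne hpq), funext fun l => ?_⟩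
    · exact Equiv.swap_apply_of_ne_of_ne (fun h => hb ⟨p, h.symm⟩) fun h => hb ⟨q, h.symm⟩
    · change Equiv.swap (f p) (f q) • t l = t l
      by_cases hl : t l ∈ Set.range i
      · obtain ⟨b, hb⟩ := hl
        rw [← hb, ← map_smul, Equiv.Perm.smul_def, Equiv.swap_apply_of_ne_of_ne]
        · rintro rfl
          exact hp ⟨l, hb.symm⟩
        · rintro rfl
          exact hq ⟨l, hb.symm⟩
      · exact hfix _ hl _
  · refine Subtype.ext (perm_eq_one_of_forall_ne (f (Fin.last _)) fun b hb => ?_)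
    by_cases hbf : b ∈ Set.range f
    · obtain ⟨l, rfl⟩ := hbf
      cases l using Fin.lastCases with
      | last => exact absurd rfl hb
      | cast l => exact hi ((map_smul i σ _).trans (congrFun hσt l))
    · exact (mem_fixingSubgroup_iff _).1 hσ b hbf

end Perm

/-! ### The inclusion of symmetric groups -/

section SymmetricGroup

variable {n : ℕ}

theorem symEmb_castSucc (σ : Equiv.Perm (Fin n)) (i : Fin n) :
    symEmb n σ i.castSucc = (σ i).castSucc :=
  Equiv.Perm.viaEmbedding_apply σ Fin.castSuccEmb i

theorem symEmb_of_notMem_range (σ : Equiv.Perm (Fin n)) {x : Fin (n + 1)}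
    (hx : x ∉ Set.range (Fin.castSucc (n := n))) : symEmb n σ x = x :=
  Equiv.Perm.viaEmbedding_apply_of_notMem σ Fin.castSuccEmb x hx

theorem symEmb_last (σ : Equiv.Perm (Fin n)) : symEmb n σ (Fin.last n) = Fin.last n :=
  symEmb_of_notMem_range σ fun ⟨i, hi⟩ => i.castSucc_ne_last hi

theorem range_symEmb (n : ℕ) :
    (symEmb n).range = MulAction.stabilizer (Equiv.Perm (Fin (n + 1))) (Fin.last n) := by
  refine le_antisymm ?_ fun g hg => ?_
  · rintro _ ⟨σ, rfl⟩
    exact symEmb_last σ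
  have hne (i : Fin n) : g i.castSucc ≠ Fin.last n := fun h =>
    i.castSucc_ne_last (g.injective (h.trans hg.symm))
  let f (i : Fin n) : Fin n := (g i.castSucc).castPred (hne i)
  have hf : Function.Injective f := fun i j hij =>
    Fin.castSucc_injective n (g.injective (Fin.castPred_inj.1 hij))
  refine ⟨Equiv.ofBijective f (Finite.injective_iff_bijective.1 hf), Equiv.ext fun x => ?_⟩
  cases x using Fin.lastCases with
  | last => exact (symEmb_last _).trans hg.symm
  | cast i => simp [symEmb_castSucc, f]

theorem not_isIndependentTuple_perm_fin (t : Fin (n + 1) → Fin (n + 1)) :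
    ¬ IsIndependentTuple (Equiv.Perm (Fin (n + 1))) t :=
  not_isIndependentTuple_of_card_le (i := .id _) Function.injective_id
    (fun x hx => absurd ⟨x, rfl⟩ hx) (Fintype.card_fin _).le t

theorem hasSignObstruction_perm_fin {j : ℕ} (hj : j < n) :
    HasSignObstruction (Equiv.Perm (Fin (n + 1))) (Fin (n + 1)) j :=
  hasSignObstruction_of_le_card (i := .id _) Function.injective_id
    (fun x hx => absurd ⟨x, rfl⟩ hx) (by simpa using hj)

variable (k : Type*) [Field k]

theorem isMinHDepth_symEmb (n : ℕ) : IsMinHDepth (groupSubalgebra k (symEmb n)) (2 * n + 1) :=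
  isMinHDepth_groupSubalgebra (range_symEmb n) not_isIndependentTuple_perm_fin
    fun _ => hasSignObstruction_perm_fin

theorem isMinModuleDepth_permutationModule_symEmb (n : ℕ) :
    IsMinModuleDepth (permutationModule (groupSubalgebra k (symEmb n))) n := by
  obtain ⟨b, hb⟩ := exists_isPermutationBasis_permutationModule (k := k) (range_symEmb n)
  exact hb.isMinModuleDepth (MulEquiv.surjective _) not_isIndependentTuple_perm_fin
    fun _ => hasSignObstruction_perm_fin

theorem isMinModuleDepth_permutationModule_comp_symEmb (hn : 1 ≤ n) :
    IsMinModuleDepth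
      ((permutationModule (groupSubalgebra k (symEmb n))).comp (MonoidHom.op (symEmb n)))
      (n - 1) := by
  let _ : MulAction (Equiv.Perm (Fin n)) (Fin (n + 1)) := .compHom _ (symEmb n)
  let incl : Fin n →[Equiv.Perm (Fin n)] Fin (n + 1) :=
    ⟨Fin.castSucc, fun σ i => (symEmb_castSucc σ i).symm⟩
  have hincl : Function.Injective incl := Fin.castSucc_injective n
  have hfix : ∀ x ∉ Set.range incl, ∀ σ : Equiv.Perm (Fin n), σ • x = x :=
    fun x hx σ => symEmb_of_notMem_range σ hx
  obtain ⟨b, hb⟩ := exists_isPermutationBasis_permutationModule (k := k) (range_symEmb n)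
  have hcard : Fintype.card (Fin n) = n - 1 + 1 := by
    rw [Fintype.card_fin, Nat.sub_add_cancel hn]
  exact (hb.comp_op fun _ _ => rfl).isMinModuleDepth (MulEquiv.surjective _)
    (not_isIndependentTuple_of_card_le hincl hfix hcard.le)
    fun j hj => hasSignObstruction_of_le_card hincl hfix (by omega)

end SymmetricGroup

end SubalgebraDepth

open SubalgebraDepth in
theorem mainTheorem11_general (k : Type*) [Field k] (n : ℕ) (hn : 1 ≤ n) :
    IsMinHDepth (groupSubalgebra k (symEmb n)) (2 * n + 1) ∧
    IsMinModuleDepth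
      ((permutationModule (groupSubalgebra k (symEmb n))).comp (MonoidHom.op (symEmb n)))
      (n - 1) ∧
    IsMinModuleDepth (permutationModule (groupSubalgebra k (symEmb n))) n :=
  ⟨isMinHDepth_symEmb k n, isMinModuleDepth_permutationModule_comp_symEmb k hn,
    isMinModuleDepth_permutationModule_symEmb k n⟩

theorem mainTheorem11 (n : ℕ) (hn : 1 ≤ n) :
    SubalgebraDepth.IsMinHDepth (SubalgebraDepth.symSubalgebra n) (2 * n + 1) ∧
    SubalgebraDepth.IsMinModuleDepth (SubalgebraDepth.symPermRes n) (n - 1) ∧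
    SubalgebraDepth.IsMinModuleDepth (SubalgebraDepth.symPerm n) n :=
  mainTheorem11_general ℂ n hn
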